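/- **Setting.** Types are given by $T ::= A \mid T_1\Rightarrow T_2$, where $A$ is one base type. Let $a$ and $f$ be two fixed constants and let $x$ range over a countably infinite set of variables; terms are taken up to renaming of $\lambda$-bound variables. - Standard terms: $t ::= x \mid \lambda x{:}T.\,t \mid t\ t' \mid a \mid f$. - Mixed terms: $m ::= x \mid \lambda x{:}T.\,m \mid m\ m' \mid a \mid f \mid A \mid T\Rightarrow m$; in particular every standard term and every type is a mixed term. - Standard values: $v ::= \lambda x{:}T.\,t \mid a \mid f$ with $t$ a standard term. Mixed values: $u ::= \lambda x{:}T.\,m \mid T\Rightarrow m \mid A \mid a \mid f$. - Call-by-value evaluation contexts: $E_c ::= * \mid (E_c\ m) \mid (u\ E_c)$. Unrestricted contexts: $E_a ::= * \mid (E_a\ m) \mid (m\ E_a) \mid \lambda x{:}T.\,E_a \mid T\Rightarrow E_a$. Write $[m'/x]m$ for capture-avoiding substitution and $E[m]$ for grafting $m$ at the hole $*$ of $E$. Concrete call-by-value reduction $\to_c$ is given by $$E_c[f\ a]\to_c E_c[a],\qquad E_c[(\lambda x{:}T.\,m)\ u]\to_c E_c[[u/x]m]\quad(u\text{ a mixed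 value}),$$ and abstract reduction $\to_a$ by $$E_a[(T\Rightarrow m)\ T]\to_a E_a[m],\quad E_a[\lambda x{:}T.\,m]\to_a E_a[T\Rightarrow [T/x]m],\quad E_a[f]\to_a E_a[A\Rightarrow A],\quad E_a[a]\to_a E_a[A].$$ Let $\to_{ca}$ be the union $\to_c\cup\to_a$, let $\to^*$ denote the reflexive transitive closure of $\to$, and write $m\not\to_c$ if there is no $m'$ with $m\to_c m'$. **Theorem.** Let $t$ be a closed standard term and $T$ a type such that $t\to_{ca}^* T$. 1. (Generalized Type Safety) If $t\to_c^* t'$ and $t'\not\to_c$, then $t'$ is a standard value. 2. (Generalized Progress) If $t\not\to_c$, then $t$ is a standard value. -/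

import Mathlib

namespace STLC

/-- Simple types `T ::= A | T₁ ⇒ T₂` over the single base type `A`. -/
inductive Ty : Type
  | base : Ty
  | arrow : Ty → Ty → Ty

/-- Mixed terms `m ::= x | λ x:T. m | m m' | a | f | A | T ⇒ m`, up to renaming of bound variables:
variables are de Bruijn indices, and `lam` is the only binder. An index that is not less than the
number of enclosing `lam`s stands for a free variable. -/
inductive Mixed : Type
  | var : ℕ → Mixed
  | lam : Ty → Mixed → Mixed
  | app : Mixed → Mixed → Mixed
  | cA : Mixed
  | cF : Mixed
  | base : Mixed
  | arrow : Ty → Mixed → Mixed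

/-- Every type is a mixed term. -/
def Ty.toMixed : Ty → Mixed
  | .base => .base
  | .arrow T₁ T₂ => .arrow T₁ T₂.toMixed

/-- Standard terms `t ::= x | λ x:T. t | t t' | a | f`, as mixed terms. -/
inductive IsStandard : Mixed → Prop
  | var (n : ℕ) : IsStandard (.var n)
  | lam (T : Ty) {t : Mixed} : IsStandard t → IsStandard (.lam T t)
  | app {t s : Mixed} : IsStandard t → IsStandard s → IsStandard (.app t s)
  | cA : IsStandard .cA
  | cF : IsStandard .cF

/-- Standard values `v ::= λ x:T. t | a | f`, with `t` a standard term. -/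
inductive IsStandardValue : Mixed → Prop
  | lam (T : Ty) {t : Mixed} : IsStandard t → IsStandardValue (.lam T t)
  | cA : IsStandardValue .cA
  | cF : IsStandardValue .cF

/-- Mixed values `u ::= λ x:T. m | T ⇒ m | A | a | f`. -/
inductive IsMixedValue : Mixed → Prop
  | lam (T : Ty) (m : Mixed) : IsMixedValue (.lam T m)
  | arrow (T : Ty) (m : Mixed) : IsMixedValue (.arrow T m)
  | base : IsMixedValue .base
  | cA : IsMixedValue .cA
  | cF : IsMixedValue .cF

/-- `FreeIn i m`: the `i`-th free variable of the ambient scope occurs in `m`. -/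
def FreeIn : ℕ → Mixed → Prop
  | i, .var n => n = i
  | i, .lam _ m => FreeIn (i + 1) m
  | i, .app m₁ m₂ => FreeIn i m₁ ∨ FreeIn i m₂
  | _, .cA => False
  | _, .cF => False
  | _, .base => False
  | i, .arrow _ m => FreeIn i m

/-- A term is closed if it has no free variables. -/
def Closed (m : Mixed) : Prop := ∀ i, ¬ FreeIn i m

/-- Lift a renaming under one binder. -/
def upRen (ξ : ℕ → ℕ) : ℕ → ℕ
  | 0 => 0
  | n + 1 => ξ n + 1

/-- Renaming of free variables. -/
def Mixed.rename : (ℕ → ℕ) → Mixed → Mixed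
  | ξ, .var n => .var (ξ n)
  | ξ, .lam T m => .lam T (m.rename (upRen ξ))
  | ξ, .app m₁ m₂ => .app (m₁.rename ξ) (m₂.rename ξ)
  | _, .cA => .cA
  | _, .cF => .cF
  | _, .base => .base
  | ξ, .arrow T m => .arrow T (m.rename ξ)

/-- Lift a substitution under one binder. -/
def upSub (σ : ℕ → Mixed) : ℕ → Mixed
  | 0 => .var 0
  | n + 1 => (σ n).rename Nat.succ

/-- Simultaneous capture-avoiding substitution. -/
def Mixed.subst : (ℕ → Mixed) → Mixed → Mixed
  | σ, .var n => σ n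
  | σ, .lam T m => .lam T (m.subst (upSub σ))
  | σ, .app m₁ m₂ => .app (m₁.subst σ) (m₂.subst σ)
  | _, .cA => .cA
  | _, .cF => .cF
  | _, .base => .base
  | σ, .arrow T m => .arrow T (m.subst σ)

/-- The substitution that replaces the variable `0` by `u` and lowers the other variables. -/
def instSub (u : Mixed) : ℕ → Mixed
  | 0 => u
  | n + 1 => .var n

/-- `m.inst u` is `[u/x]m`, where `m` is the body of an abstraction over `x`. -/
def Mixed.inst (m u : Mixed) : Mixed := m.subst (instSub u)

/-- Call-by-value evaluation contexts `E_c ::= * | (E_c m) | (u E_c)`, with `u` a mixed value. -/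
inductive CbvCtx : Type
  | hole : CbvCtx
  | appL : CbvCtx → Mixed → CbvCtx
  | appR : (u : Mixed) → IsMixedValue u → CbvCtx → CbvCtx

/-- Unrestricted evaluation contexts `E_a ::= * | (E_a m) | (m E_a) | λ x:T. E_a | T ⇒ E_a`. -/
inductive FullCtx : Type
  | hole : FullCtx
  | appL : FullCtx → Mixed → FullCtx
  | appR : Mixed → FullCtx → FullCtx
  | lam : Ty → FullCtx → FullCtx
  | arrow : Ty → FullCtx → FullCtx

/-- `E.fill m` is `E_c[m]`. -/
def CbvCtx.fill : CbvCtx → Mixed → Mixed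
  | .hole, m => m
  | .appL E m', m => .app (E.fill m) m'
  | .appR u _ E, m => .app u (E.fill m)

/-- `E.fill m` is `E_a[m]` (grafting: variables of `m` may be bound by `E`). -/
def FullCtx.fill : FullCtx → Mixed → Mixed
  | .hole, m => m
  | .appL E m', m => .app (E.fill m) m'
  | .appR m' E, m => .app m' (E.fill m)
  | .lam T E, m => .lam T (E.fill m)
  | .arrow T E, m => .arrow T (E.fill m)

/-- Concrete call-by-value reduction `→_c`. -/
inductive StepC : Mixed → Mixed → Prop
  | fbeta (E : CbvCtx) : StepC (E.fill (.app .cF .cA)) (E.fill .cA)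
  | beta (E : CbvCtx) (T : Ty) (m u : Mixed) : IsMixedValue u →
      StepC (E.fill (.app (.lam T m) u)) (E.fill (m.inst u))

/-- Abstract reduction `→_a`. -/
inductive StepA : Mixed → Mixed → Prop
  | beta (E : FullCtx) (T : Ty) (m : Mixed) :
      StepA (E.fill (.app (.arrow T m) T.toMixed)) (E.fill m)
  | lam (E : FullCtx) (T : Ty) (m : Mixed) :
      StepA (E.fill (.lam T m)) (E.fill (.arrow T (m.inst T.toMixed)))
  | cF (E : FullCtx) : StepA (E.fill .cF) (E.fill (.arrow .base .base))
  | cA (E : FullCtx) : StepA (E.fill .cA) (E.fill .base)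

/-- Combined reduction `→_ca`, the union of `→_c` and `→_a`. -/
def StepCA (m m' : Mixed) : Prop := StepC m m' ∨ StepA m m'

/-- `m` is normal for `→_c`. -/
def NormalC (m : Mixed) : Prop := ∀ m', ¬ StepC m m'

end STLC

namespace STLC

open Relation

/-! ### Substitution calculus -/

/-! Progress rests on an invariant. A standard term normal for `→_c` is a standard value or `Stuck`
(`IsStandard.isStandardValue_or_stuck`). Stuck terms have no concrete step, stay stuck under
abstract steps and are never types, so they cannot reach a type (`Stuck.not_reaches_type`).

Type safety follows once a concrete step `m → n` is known to preserve reachability of a type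
(`Contracts.reaches_type`). The reduction of `m` to the type is replayed from `n`, and `Contracts`
tracks the redex as abstract steps deform it. Each abstract step is matched from `n`, or it consumes
the abstracted redex and `n` reaches the same term. The only possible concrete step is the
contraction itself. Types contain no redex, so the tracked one must disappear before the end. -/

theorem upSub_var_comp (ξ : ℕ → ℕ) :
    upSub (fun n => .var (ξ n)) = fun n => .var (upRen ξ n) := by
  funext n; cases n <;> rfl

theorem Mixed.rename_eq_subst (m : Mixed) (ξ : ℕ → ℕ) :
    m.rename ξ = m.subst (fun n => .var (ξ n)) := by
  induction m generalizing ξ <;> simp_all [Mixed.rename, Mixed.subst, upSub_var_comp]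

theorem upSub_var : upSub Mixed.var = Mixed.var := by
  funext n; cases n <;> rfl

theorem Mixed.subst_var (m : Mixed) : m.subst .var = m := by
  induction m <;> simp_all [Mixed.subst, upSub_var]

theorem upSub_comp_upRen (σ : ℕ → Mixed) (ξ : ℕ → ℕ) :
    (fun n => upSub σ (upRen ξ n)) = upSub (fun n => σ (ξ n)) := by
  funext n; cases n <;> rfl

theorem Mixed.subst_rename (m : Mixed) (ξ : ℕ → ℕ) (σ : ℕ → Mixed) :
    (m.rename ξ).subst σ = m.subst (fun n => σ (ξ n)) := by
  induction m generalizing ξ σ <;> simp_all [Mixed.rename, Mixed.subst, upSub_comp_upRen]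

theorem Mixed.rename_succ_rename (m : Mixed) (ξ : ℕ → ℕ) :
    (m.rename ξ).rename Nat.succ = (m.rename Nat.succ).rename (upRen ξ) := by
  rw [Mixed.rename_eq_subst _ Nat.succ, Mixed.rename_eq_subst _ (upRen ξ),
    Mixed.subst_rename, Mixed.subst_rename]
  rfl

theorem upSub_rename (σ : ℕ → Mixed) (ξ : ℕ → ℕ) :
    (fun n => (upSub σ n).rename (upRen ξ)) = upSub (fun n => (σ n).rename ξ) := by
  funext n
  cases n with
  | zero => rfl
  | succ n => exact (Mixed.rename_succ_rename _ _).symm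

theorem Mixed.rename_subst (m : Mixed) (ξ : ℕ → ℕ) (σ : ℕ → Mixed) :
    (m.subst σ).rename ξ = m.subst (fun n => (σ n).rename ξ) := by
  induction m generalizing ξ σ <;> simp_all [Mixed.rename, Mixed.subst, upSub_rename]

theorem upSub_subst (σ τ : ℕ → Mixed) :
    (fun n => (upSub σ n).subst (upSub τ)) = upSub (fun n => (σ n).subst τ) := by
  funext n
  cases n with
  | zero => rfl
  | succ n => simp only [upSub, Mixed.subst_rename, Mixed.rename_subst]

theorem Mixed.subst_subst (m : Mixed) (σ τ : ℕ → Mixed) :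
    (m.subst σ).subst τ = m.subst (fun n => (σ n).subst τ) := by
  induction m generalizing σ τ <;> simp_all [Mixed.subst, upSub_subst]

theorem Ty.toMixed_subst (T : Ty) (σ : ℕ → Mixed) : T.toMixed.subst σ = T.toMixed := by
  induction T <;> simp_all [Ty.toMixed, Mixed.subst]

theorem Mixed.subst_inst (m u : Mixed) (σ : ℕ → Mixed) :
    (m.inst u).subst σ = (m.subst (upSub σ)).inst (u.subst σ) := by
  simp only [Mixed.inst, Mixed.subst_subst]
  congr 1
  funext n
  cases n with
  | zero => rfl
  | succ n =>
    simp only [upSub, Mixed.subst_rename, instSub, Mixed.subst]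
    exact (Mixed.subst_var _).symm

/-! ### Structural presentations of the two reductions -/

/-- Call-by-value reduction, with the evaluation contexts unfolded into congruence rules. -/
inductive CStep : Mixed → Mixed → Prop
  | delta : CStep (.app .cF .cA) .cA
  | beta (T : Ty) (m : Mixed) {u : Mixed} : IsMixedValue u → CStep (.app (.lam T m) u) (m.inst u)
  | appL {m m' : Mixed} (p : Mixed) : CStep m m' → CStep (.app m p) (.app m' p)
  | appR {u m m' : Mixed} : IsMixedValue u → CStep m m' → CStep (.app u m) (.app u m')

/-- Abstract reduction, with the contexts unfolded into congruence rules. -/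
inductive AStep : Mixed → Mixed → Prop
  | beta (T : Ty) (m : Mixed) : AStep (.app (.arrow T m) T.toMixed) m
  | abs (T : Ty) (m : Mixed) : AStep (.lam T m) (.arrow T (m.inst T.toMixed))
  | cF : AStep .cF (.arrow .base .base)
  | cA : AStep .cA .base
  | appL {m m' : Mixed} (p : Mixed) : AStep m m' → AStep (.app m p) (.app m' p)
  | appR (p : Mixed) {m m' : Mixed} : AStep m m' → AStep (.app p m) (.app p m')
  | lam (T : Ty) {m m' : Mixed} : AStep m m' → AStep (.lam T m) (.lam T m')
  | arrow (T : Ty) {m m' : Mixed} : AStep m m' → AStep (.arrow T m) (.arrow T m')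

theorem CStep.fill {m m' : Mixed} (h : CStep m m') (E : CbvCtx) :
    CStep (E.fill m) (E.fill m') := by
  induction E with
  | hole => exact h
  | appL E p ih => exact .appL p ih
  | appR u hu E ih => exact .appR hu ih

theorem StepC.appL {m m' : Mixed} (p : Mixed) (h : StepC m m') :
    StepC (.app m p) (.app m' p) := by
  cases h with
  | fbeta E => exact .fbeta (.appL E p)
  | beta E T m u hu => exact .beta (.appL E p) T m u hu

theorem StepC.appR {u m m' : Mixed} (hv : IsMixedValue u) (h : StepC m m') :
    StepC (.app u m) (.app u m') := by
  cases h with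
  | fbeta E => exact .fbeta (.appR u hv E)
  | beta E T m w hw => exact .beta (.appR u hv E) T m w hw

theorem stepC_iff_cStep {m m' : Mixed} : StepC m m' ↔ CStep m m' := by
  constructor
  · rintro (E | ⟨E, T, m, u, hu⟩)
    · exact CStep.delta.fill E
    · exact (CStep.beta T m hu).fill E
  · intro h
    induction h with
    | delta => exact .fbeta .hole
    | beta T m hu => exact .beta .hole T m _ hu
    | appL p _ ih => exact ih.appL p
    | appR hu _ ih => exact ih.appR hu

theorem AStep.fill {m m' : Mixed} (h : AStep m m') (E : FullCtx) :
    AStep (E.fill m) (E.fill m') := by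
  induction E with
  | hole => exact h
  | appL E p ih => exact .appL p ih
  | appR p E ih => exact .appR p ih
  | lam T E ih => exact .lam T ih
  | arrow T E ih => exact .arrow T ih

theorem StepA.aStep {m m' : Mixed} (h : StepA m m') : AStep m m' := by
  cases h with
  | beta E T m => exact (AStep.beta T m).fill E
  | lam E T m => exact (AStep.abs T m).fill E
  | cF E => exact AStep.cF.fill E
  | cA E => exact AStep.cA.fill E

/-- Combined reduction in structural form. -/
def CAStep (m m' : Mixed) : Prop := CStep m m' ∨ AStep m m'

theorem StepCA.caStep {m m' : Mixed} (h : StepCA m m') : CAStep m m' :=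
  h.imp stepC_iff_cStep.1 StepA.aStep

/-! ### Values -/

/-- Call-by-value contexts enter neither `λ` nor `⇒`, so values evolve by abstract steps only. This
is why the condition in `Contracts.arrow` mentions `AStep` alone. -/
theorem IsMixedValue.not_cStep {u m : Mixed} (hu : IsMixedValue u) : ¬ CStep u m := by
  intro h
  cases hu <;> cases h

theorem IsMixedValue.aStep {u u' : Mixed} (hu : IsMixedValue u) (h : AStep u u') :
    IsMixedValue u' := by
  cases hu <;> cases h <;> constructor

theorem Ty.isMixedValue_toMixed (T : Ty) : IsMixedValue T.toMixed := by
  cases T <;> constructor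

theorem not_isMixedValue_app (m p : Mixed) : ¬ IsMixedValue (.app m p) := nofun

/-! ### Abstract reduction and substitution -/

/-- Types are closed, so a substitution disturbs neither the argument of an abstract redex nor the
type put in for a bound variable. -/
theorem AStep.subst {m m' : Mixed} (h : AStep m m') (σ : ℕ → Mixed) :
    AStep (m.subst σ) (m'.subst σ) := by
  induction h generalizing σ with
  | beta T m =>
    simp only [Mixed.subst, Ty.toMixed_subst]
    exact .beta T _
  | abs T m =>
    simp only [Mixed.subst, Mixed.subst_inst, Ty.toMixed_subst]
    exact .abs T _
  | cF => exact .cF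
  | cA => exact .cA
  | appL p _ ih => exact .appL _ (ih σ)
  | appR p _ ih => exact .appR _ (ih σ)
  | lam T _ ih => exact .lam T (ih _)
  | arrow T _ ih => exact .arrow T (ih σ)

theorem aStep_upSub {σ τ : ℕ → Mixed} (h : ∀ n, ReflTransGen AStep (σ n) (τ n))
    (n : ℕ) : ReflTransGen AStep (upSub σ n) (upSub τ n) := by
  cases n with
  | zero => exact .refl
  | succ n =>
    simp only [upSub, Mixed.rename_eq_subst]
    exact (h n).lift _ fun _ _ hs => hs.subst _

/-- Abstract steps are allowed in every position, so each occurrence of a substituted term can be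
reduced separately. -/
theorem Mixed.aStep_subst (m : Mixed) {σ τ : ℕ → Mixed}
    (h : ∀ n, ReflTransGen AStep (σ n) (τ n)) :
    ReflTransGen AStep (m.subst σ) (m.subst τ) := by
  induction m generalizing σ τ with
  | var n => exact h n
  | lam T m ih =>
    exact (ih (aStep_upSub h)).lift (Mixed.lam T) fun _ _ => AStep.lam T
  | app m p ihm ihp =>
    exact ((ihm h).lift (fun x => Mixed.app x _) fun _ _ => AStep.appL _).trans
      ((ihp h).lift (fun x => Mixed.app _ x) fun _ _ => AStep.appR _)
  | cA => exact .refl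
  | cF => exact .refl
  | base => exact .refl
  | arrow T m ih => exact (ih h).lift (Mixed.arrow T) fun _ _ => AStep.arrow T

theorem Mixed.aStep_inst (m : Mixed) {u u' : Mixed} (h : ReflTransGen AStep u u') :
    ReflTransGen AStep (m.inst u) (m.inst u') := by
  refine m.aStep_subst fun n => ?_
  cases n with
  | zero => exact h
  | succ n => exact .refl

/-! ### Combined reduction in call-by-value position -/

theorem caStep_of_aStep {m m' : Mixed} (h : ReflTransGen AStep m m') :
    ReflTransGen CAStep m m' :=
  ReflTransGen.mono (fun _ _ => Or.inr) _ _ h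

theorem caStep_of_stepCA {m m' : Mixed} (h : ReflTransGen StepCA m m') :
    ReflTransGen CAStep m m' :=
  ReflTransGen.mono (fun _ _ => StepCA.caStep) _ _ h

theorem caStep_appL {m m' : Mixed} (p : Mixed) (h : ReflTransGen CAStep m m') :
    ReflTransGen CAStep (.app m p) (.app m' p) :=
  h.lift (fun x => Mixed.app x p) fun _ _ => Or.imp (.appL p) (.appL p)

theorem caStep_appR {u m m' : Mixed} (hu : IsMixedValue u)
    (h : ReflTransGen CAStep m m') : ReflTransGen CAStep (.app u m) (.app u m') :=
  h.lift (fun x => Mixed.app u x) fun _ _ => Or.imp (.appR hu) (.appR u)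

/-! ### Concrete steps preserve reducibility to a type -/

/-- `Contracts m n`: in call-by-value position, `m` has a concrete redex, possibly with parts
already abstracted, and `n` results from contracting it. An abstracted redex `(T ⇒ m) u` can only
be consumed once `u` has been reduced to `T`, so its contractum need only reduce to `m` under that
assumption. -/
inductive Contracts : Mixed → Mixed → Prop
  | delta : Contracts (.app .cF .cA) .cA
  | deltaBase : Contracts (.app .cF .base) .cA
  | beta (T : Ty) (m : Mixed) {u : Mixed} : IsMixedValue u →
      Contracts (.app (.lam T m) u) (m.inst u)
  | arrow {T : Ty} {m u n : Mixed} : IsMixedValue u →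
      (ReflTransGen AStep u T.toMixed → ReflTransGen AStep n m) →
      Contracts (.app (.arrow T m) u) n
  | appL {m n : Mixed} (p : Mixed) : Contracts m n → Contracts (.app m p) (.app n p)
  | appR {u m n : Mixed} : IsMixedValue u → Contracts m n → Contracts (.app u m) (.app u n)

theorem CStep.contracts {m m' : Mixed} (h : CStep m m') : Contracts m m' := by
  induction h with
  | delta => exact .delta
  | beta T m hu => exact .beta T m hu
  | appL p _ ih => exact .appL p ih
  | appR hu _ ih => exact .appR hu ih

theorem Contracts.not_isMixedValue {m n : Mixed} (h : Contracts m n) : ¬ IsMixedValue m := by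
  cases h <;> exact not_isMixedValue_app _ _

/-- Call-by-value reduction is deterministic; once the redex is partly abstracted it admits no
concrete step and the claim is vacuous. -/
theorem Contracts.cStep {m n m' : Mixed} (h : Contracts m n) (hs : CStep m m') : m' = n := by
  induction h generalizing m' with
  | delta =>
    cases hs with
    | delta => rfl
    | appL _ hs => cases hs
    | appR _ hs => cases hs
  | deltaBase =>
    cases hs with
    | appL _ hs => cases hs
    | appR _ hs => cases hs
  | beta T m hu =>
    cases hs with
    | beta _ _ _ => rfl
    | appL _ hs => cases hs
    | appR _ hs => exact absurd hs hu.not_cStep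
  | arrow hu _ =>
    cases hs with
    | appL _ hs => cases hs
    | appR _ hs => exact absurd hs hu.not_cStep
  | appL p h ih =>
    cases hs with
    | delta => exact absurd .cF h.not_isMixedValue
    | beta T m _ => exact absurd (.lam T m) h.not_isMixedValue
    | appL _ hs => rw [ih hs]
    | appR hu _ => exact absurd hu h.not_isMixedValue
  | appR hu h ih =>
    cases hs with
    | delta => exact absurd .cA h.not_isMixedValue
    | beta T m hv => exact absurd hv h.not_isMixedValue
    | appL _ hs => exact absurd hs hu.not_cStep
    | appR _ hs => rw [ih hs]

/-- The simulation diagram. The second alternative originates in the firing of an abstracted redex,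
after which nothing remains to track. -/
theorem Contracts.aStep {m n m' : Mixed} (h : Contracts m n) (hs : AStep m m') :
    (∃ n', ReflTransGen CAStep n n' ∧ Contracts m' n') ∨ ReflTransGen CAStep n m' := by
  induction h generalizing m' with
  | delta =>
    cases hs with
    | appL _ hs =>
      cases hs
      -- For `(A ⇒ A) a` with contractum `a`, the required reduction from `a` to `A` is the
      -- assumption itself.
      exact .inl ⟨_, .refl, .arrow .cA fun h => h⟩
    | appR _ hs =>
      cases hs
      exact .inl ⟨_, .refl, .deltaBase⟩
  | deltaBase =>
    cases hs with
    | appL _ hs =>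
      cases hs
      exact .inl ⟨_, .refl, .arrow .base fun _ => .single .cA⟩
    | appR _ hs => cases hs
  | beta T m hu =>
    cases hs with
    | appL _ hs =>
      cases hs with
      -- If `u` reduces to `T`, then `[u/x]m` reduces to `[T/x]m`, the body of the abstracted
      -- function.
      | abs => exact .inl ⟨_, .refl, .arrow hu fun h => m.aStep_inst h⟩
      | lam _ hs => exact .inl ⟨_, .single (.inr (hs.subst _)), .beta T _ hu⟩
    | appR _ hs =>
      exact .inl ⟨_, caStep_of_aStep (m.aStep_inst (.single hs)), .beta T m (hu.aStep hs)⟩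
  | arrow hu hn =>
    cases hs with
    -- The argument is now literally `T`, so the assumption of `hn` holds trivially.
    | beta => exact .inr (caStep_of_aStep (hn .refl))
    | appL _ hs =>
      cases hs with
      | arrow _ hs => exact .inl ⟨_, .refl, .arrow hu fun h => (hn h).tail hs⟩
    | appR _ hs => exact .inl ⟨_, .refl, .arrow (hu.aStep hs) fun h => hn (.head hs h)⟩
  | appL p h ih =>
    cases hs with
    | beta T m => exact absurd (.arrow T _) h.not_isMixedValue
    | appL _ hs =>
      rcases ih hs with ⟨n', hn, hc⟩ | hn
      · exact .inl ⟨_, caStep_appL p hn, .appL p hc⟩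
      · exact .inr (caStep_appL p hn)
    | appR _ hs => exact .inl ⟨_, .single (.inr (.appR _ hs)), .appL _ h⟩
  | appR hu h ih =>
    cases hs with
    | beta T m => exact absurd T.isMixedValue_toMixed h.not_isMixedValue
    | appL _ hs => exact .inl ⟨_, .single (.inr (.appL _ hs)), .appR (hu.aStep hs) h⟩
    | appR _ hs =>
      rcases ih hs with ⟨n', hn, hc⟩ | hn
      · exact .inl ⟨_, caStep_appR hu hn, .appR hu hc⟩
      · exact .inr (caStep_appR hu hn)

theorem Contracts.reaches_type {m n : Mixed} {T : Ty} (h : Contracts m n)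
    (hm : ReflTransGen CAStep m T.toMixed) : ReflTransGen CAStep n T.toMixed := by
  induction hm using ReflTransGen.head_induction_on generalizing n with
  | refl => exact absurd T.isMixedValue_toMixed h.not_isMixedValue
  | head hs hr ih =>
    rcases hs with hs | hs
    · rwa [← h.cStep hs]
    · rcases h.aStep hs with ⟨n', hn, hc⟩ | hn
      · exact hn.trans (ih hc)
      · exact hn.trans hr

/-! ### Stuck terms -/

/-- Values that do not reduce to the base type. -/
inductive IsFunctional : Mixed → Prop
  | lam (T : Ty) (m : Mixed) : IsFunctional (.lam T m)
  | arrow (T : Ty) (m : Mixed) : IsFunctional (.arrow T m)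
  | cF : IsFunctional .cF

/-- Terms with a free variable or an ill-typed application of a constant in call-by-value
position. -/
inductive Stuck : Mixed → Prop
  | var (n : ℕ) : Stuck (.var n)
  | cA {u : Mixed} : IsMixedValue u → Stuck (.app .cA u)
  | base {u : Mixed} : IsMixedValue u → Stuck (.app .base u)
  | cF {u : Mixed} : IsFunctional u → Stuck (.app .cF u)
  | arrow {u : Mixed} : IsFunctional u → Stuck (.app (.arrow .base .base) u)
  | appL {m : Mixed} (p : Mixed) : Stuck m → Stuck (.app m p)
  | appR {u m : Mixed} : IsMixedValue u → Stuck m → Stuck (.app u m)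

theorem IsFunctional.isMixedValue {u : Mixed} (h : IsFunctional u) : IsMixedValue u := by
  cases h <;> constructor

theorem IsFunctional.aStep {u u' : Mixed} (h : IsFunctional u) (hs : AStep u u') :
    IsFunctional u' := by
  cases h <;> cases hs <;> constructor

theorem Stuck.not_isMixedValue {m : Mixed} (h : Stuck m) : ¬ IsMixedValue m := by
  cases h <;> exact nofun

theorem Stuck.not_cStep {m m' : Mixed} (h : Stuck m) : ¬ CStep m m' := by
  intro hs
  induction h generalizing m' with
  | var n => cases hs
  | cA hu | base hu =>
    cases hs with
    | appL _ hs => cases hs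
    | appR _ hs => exact hu.not_cStep hs
  | cF hu =>
    cases hs with
    | delta => cases hu
    | appL _ hs => cases hs
    | appR _ hs => exact hu.isMixedValue.not_cStep hs
  | arrow hu =>
    cases hs with
    | appL _ hs => cases hs
    | appR _ hs => exact hu.isMixedValue.not_cStep hs
  | appL p h ih =>
    cases hs with
    | delta => exact h.not_isMixedValue .cF
    | beta T m _ => exact h.not_isMixedValue (.lam T m)
    | appL _ hs => exact ih hs
    | appR hu _ => exact h.not_isMixedValue hu
  | appR hu h ih =>
    cases hs with
    | delta => exact h.not_isMixedValue .cA
    | beta T m hv => exact h.not_isMixedValue hv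
    | appL _ hs => exact hu.not_cStep hs
    | appR _ hs => exact ih hs

/-- The delicate case is `f u` becoming `(A ⇒ A) u`: it could fire only on `A`, but a functional
value stays functional. -/
theorem Stuck.aStep {m m' : Mixed} (h : Stuck m) (hs : AStep m m') : Stuck m' := by
  induction h generalizing m' with
  | var n => cases hs
  | cA hu =>
    cases hs with
    | appL _ hs => cases hs; exact .base hu
    | appR _ hs => exact .cA (hu.aStep hs)
  | base hu =>
    cases hs with
    | appL _ hs => cases hs
    | appR _ hs => exact .base (hu.aStep hs)
  | cF hu =>
    cases hs with
    | appL _ hs => cases hs; exact .arrow hu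
    | appR _ hs => exact .cF (hu.aStep hs)
  | arrow hu =>
    cases hs with
    | beta => cases hu
    | appL _ hs =>
      cases hs with
      | arrow _ hs => cases hs
    | appR _ hs => exact .arrow (hu.aStep hs)
  | appL p h ih =>
    cases hs with
    | beta T m => exact absurd (.arrow T _) h.not_isMixedValue
    | appL _ hs => exact .appL p (ih hs)
    | appR _ hs => exact .appL _ h
  | appR hu h ih =>
    cases hs with
    | beta T m => exact absurd T.isMixedValue_toMixed h.not_isMixedValue
    | appL _ hs => exact .appR (hu.aStep hs) h
    | appR _ hs => exact .appR hu (ih hs)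

theorem Stuck.not_reaches_type {m : Mixed} {T : Ty} (h : Stuck m) :
    ¬ ReflTransGen CAStep m T.toMixed := by
  intro hm
  induction hm using ReflTransGen.head_induction_on with
  | refl => exact h.not_isMixedValue T.isMixedValue_toMixed
  | head hs _ ih =>
    rcases hs with hs | hs
    · exact h.not_cStep hs
    · exact ih (h.aStep hs)

/-! ### Standard terms -/

theorem IsStandardValue.isMixedValue {v : Mixed} (h : IsStandardValue v) : IsMixedValue v := by
  cases h <;> constructor

theorem IsStandard.isStandardValue_or_stuck {t : Mixed} (ht : IsStandard t)
    (hn : ∀ t', ¬ CStep t t') : IsStandardValue t ∨ Stuck t := by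
  induction ht with
  | var n => exact .inr (.var n)
  | lam T ht _ => exact .inl (.lam T ht)
  | cA => exact .inl .cA
  | cF => exact .inl .cF
  | app _ _ iht ihs =>
    rcases iht fun t' h => hn _ (.appL _ h) with hv | hst
    · rcases ihs fun s' h => hn _ (.appR hv.isMixedValue h) with hw | hss
      · cases hv with
        -- Among applications of a standard value to a standard value, only this one and `f a` are
        -- redexes; all others are stuck.
        | lam T _ => exact absurd (.beta T _ hw.isMixedValue) (hn _)
        | cA => exact .inr (.cA hw.isMixedValue)
        | cF =>
          cases hw with
          | lam T _ => exact .inr (.cF (.lam T _))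
          | cA => exact absurd .delta (hn _)
          | cF => exact .inr (.cF .cF)
      · exact .inr (.appR hv.isMixedValue hss)
    · exact .inr (.appL _ hst)

theorem IsStandard.rename {t : Mixed} (ht : IsStandard t) (ξ : ℕ → ℕ) :
    IsStandard (t.rename ξ) := by
  induction ht generalizing ξ with
  | var n => exact .var _
  | lam T _ ih => exact .lam T (ih _)
  | app _ _ iht ihs => exact .app (iht ξ) (ihs ξ)
  | cA => exact .cA
  | cF => exact .cF

theorem IsStandard.subst {t : Mixed} (ht : IsStandard t) {σ : ℕ → Mixed}
    (hσ : ∀ n, IsStandard (σ n)) : IsStandard (t.subst σ) := by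
  induction ht generalizing σ with
  | var n => exact hσ n
  | lam T _ ih =>
    refine .lam T (ih fun n => ?_)
    cases n with
    | zero => exact .var 0
    | succ n => exact (hσ n).rename _
  | app _ _ iht ihs => exact .app (iht hσ) (ihs hσ)
  | cA => exact .cA
  | cF => exact .cF

theorem IsStandard.cStep {t t' : Mixed} (ht : IsStandard t) (h : CStep t t') :
    IsStandard t' := by
  induction h with
  | delta => exact .cA
  | beta T m _ =>
    cases ht with
    | app hl hu =>
      cases hl with
      | lam _ hm =>
        refine hm.subst fun n => ?_
        cases n with
        | zero => exact hu
        | succ n => exact .var n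
  | appL p _ ih =>
    cases ht with
    | app hm hp => exact .app (ih hm) hp
  | appR _ _ ih =>
    cases ht with
    | app hu hm => exact .app hu (ih hm)

theorem IsStandard.progress {t : Mixed} {T : Ty} (ht : IsStandard t)
    (hT : ReflTransGen CAStep t T.toMixed) (hn : NormalC t) : IsStandardValue t :=
  (ht.isStandardValue_or_stuck fun t' h => hn t' (stepC_iff_cStep.2 h)).resolve_right
    fun hs => hs.not_reaches_type hT

theorem IsStandard.type_safety {t t' : Mixed} {T : Ty} (ht : IsStandard t)
    (hT : ReflTransGen CAStep t T.toMixed) (hs : ReflTransGen StepC t t') (hn : NormalC t') :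
    IsStandardValue t' := by
  induction hs using ReflTransGen.head_induction_on with
  | refl => exact ht.progress hT hn
  | head h _ ih =>
    have hc := stepC_iff_cStep.1 h
    exact ih (ht.cStep hc) (hc.contracts.reaches_type hT)

end STLC

theorem mainTheorem11 :
    -- Generalized Type Safety
    (∀ (t t' : STLC.Mixed) (T : STLC.Ty),
      STLC.IsStandard t → STLC.Closed t →
      Relation.ReflTransGen STLC.StepCA t T.toMixed →
      Relation.ReflTransGen STLC.StepC t t' → STLC.NormalC t' →
      STLC.IsStandardValue t') ∧
    -- Generalized Progress
    (∀ (t : STLC.Mixed) (T : STLC.Ty),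
      STLC.IsStandard t → STLC.Closed t →
      Relation.ReflTransGen STLC.StepCA t T.toMixed → STLC.NormalC t →
      STLC.IsStandardValue t) :=
  ⟨fun _ _ _ ht _ hT hs hn => ht.type_safety (STLC.caStep_of_stepCA hT) hs hn,
    fun _ _ ht _ hT hn => ht.progress (STLC.caStep_of_stepCA hT) hn⟩
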